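/- **Definitions.** A *quantale* $\mathcal V=(\mathcal V,\otimes,k)$ is a complete lattice with a commutative monoid structure such that $\otimes$ preserves all suprema in each variable; $\hom(u,-)$ denotes the right adjoint of $u\otimes-$. Let $\mathbb U=(U,e,m)$ be the ultrafilter monad on $\mathbf{Set}$. An *ultrafilter theory* is given by a map $\xi:U\mathcal V\to\mathcal V$ such that 1. $\xi$ is an Eilenberg–Moore algebra structure for $\mathbb U$: $\xi\cdot e_{\mathcal V}=1_{\mathcal V}$ and $\xi\cdot U\xi=\xi\cdot m_{\mathcal V}$; 2. $\xi(U\pi_1(\mathfrak w))\otimes\xi(U\pi_2(\mathfrak w))\le\xi(U{\otimes}(\mathfrak w))$ for all $\mathfrak w\in U(\mathcal V\times\mathcal V)$; 3. the maps $\xi_X:\mathcal V^X\to\mathcal V^{UX}$, $\varphi\mapsto\xi\cdot U\varphi$, are monotone and natural in the set $X$ for direct images: for all $f:X\to Y$, $\varphi:X\to\mathcal V$ and $\mathfrak y\in UY$, with $f_!\varphi(y)=\bigvee_{f(x)=y}\varphi(x)$, one has $\xi(U(f_!\varphi)(\mathfrak y))=\bigvee_{Uf(\mathfrak x)=\mathfrak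 y}\xi(U\varphi(\mathfrak x))$. The theory is *strict* if equality holds in 2. It is *compatible with finite suprema* if $\xi(U\pi_1(\mathfrak w))\vee\xi(U\pi_2(\mathfrak w))=\xi(U{\vee}(\mathfrak w))$ for all $\mathfrak w\in U(\mathcal V\times\mathcal V)$. For $u,v\in\mathcal V$ write $u\ll v$ if every down-set $A\subseteq\mathcal V$ with $v\le\bigvee A$ contains $u$. The unit $k$ is *approximated* if $\{u\mid u\ll k\}$ is directed (in particular non-empty) with supremum $k$; it is *terminal* if $k=\top$. A *$\mathcal V$-category* $(X,a)$ is a set $X$ with $a:X\times X\to\mathcal V$ such that $k\le a(x,x)$ and $a(x,y)\otimes a(y,z)\le a(x,z)$. A *$\mathcal V$-functor* $f:(X,a)\to(Y,b)$ is a map with $a(x,x')\le b(f(x),f(x'))$. A *$\mathcal V$-categorical compact Hausdorff space* $(X,a_0,\alpha)$ is a $\mathcal V$-category $(X,a_0)$ with an Eilenberg–Moore algebra structure $\alpha:UX\to X$ for $\mathbb U$ (the convergence of a compact Hausdorff topology) such that $U_\xi a_0(\mathfrak x,\mathfrak y)\le a_0(\alpha(\mathfrak x),\alpha(\mathfrak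 y))$ for all $\mathfrak x,\mathfrak y\in UX$, where $$U_\xi a_0(\mathfrak x,\mathfrak y)=\bigvee\{\xi(Ua_0(\mathfrak w))\mid \mathfrak w\in U(X\times X),\ U\pi_1(\mathfrak w)=\mathfrak x,\ U\pi_2(\mathfrak w)=\mathfrak y\}.$$ With $G=(1,k)$ the one-point $\mathcal V$-category, a *$\mathcal V$-distributor* $\varphi:G\nrightarrow X$ is a map $\varphi:X\to\mathcal V$ with $\varphi(x)\otimes a(x,y)\le\varphi(y)$. These form a $\mathcal V$-category with structure $[\varphi,\psi]=\bigwedge_{x\in X}\hom(\varphi(x),\psi(x))$. A distributor $\varphi_0:G\nrightarrow X$ is *codirected* if for all $\varphi,\varphi':G\nrightarrow X$ and $u\in\mathcal V$ $$[\varphi_0,\bot]=\bot,\qquad[\varphi_0,\varphi\vee\varphi']=[\varphi_0,\varphi]\vee[\varphi_0,\varphi'],\qquad[\varphi_0,u\otimes\varphi]=u\otimes[\varphi_0,\varphi].$$ Let $\Phi(X)$ be the $\mathcal V$-category of codirected distributors $G\nrightarrow X$ with structure $(\varphi,\psi)\mapsto[\psi,\varphi]$. The $\mathcal V$-category $X$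 is *codirected complete* if the $\mathcal V$-functor $X\to\Phi(X)$, $x\mapsto a(x,-)$, has a right adjoint $\mathcal V$-functor $\inf:\Phi(X)\to X$; that is, every codirected $\varphi:G\nrightarrow X$ has an infimum, an element $y\in X$ with $[\varphi,a(x,-)]=a(x,y)$ for all $x\in X$. **Theorem.** Let $(\mathbb U,\mathcal V,\xi)$ be a strict ultrafilter theory compatible with finite suprema, where the lattice $\mathcal V$ is completely distributive, $\xi(\mathfrak v)=\bigwedge_{A\in\mathfrak v}\bigvee A$ for all $\mathfrak v\in U\mathcal V$, and $k$ is terminal and approximated. Then for every $\mathcal V$-categorical compact Hausdorff space $(X,a_0,\alpha)$, the $\mathcal V$-category $(X,a_0)$ is codirected complete. -/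

import Mathlib

open scoped Quantale

universe u

namespace UltraTheory

/-! ### Quantales

A (commutative, unital) quantale is given by `[CompleteLattice V] [CommMonoid V] [IsQuantale V]`;
the tensor product is written `*`, the neutral element `1`, and the internal hom of `V` is
Mathlib's residuation `u ⇨ᵣ w`, characterised by `v ≤ (u ⇨ᵣ w) ↔ u * v ≤ w`. -/

/-- `x` is totally below `y`. -/
def TotallyBelow {V : Type u} [CompleteLattice V] (x y : V) : Prop :=
  ∀ A : LowerSet V, y ≤ sSup (A : Set V) → x ∈ A

/-- The neutral element is approximated: the set `{u | u ≪ 1}` is directed (in particular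
non-empty) and its supremum is the neutral element. -/
def UnitApproximated (V : Type u) [CompleteLattice V] [CommMonoid V] : Prop :=
  {u : V | TotallyBelow u 1}.Nonempty ∧
  DirectedOn (· ≤ ·) {u : V | TotallyBelow u 1} ∧
  IsLUB {u : V | TotallyBelow u 1} 1

/-! ### Ultrafilter theories

The functor part of the ultrafilter monad is `X ↦ Ultrafilter X`, `f ↦ Ultrafilter.map f`, its unit
is `pure`, and its multiplication is the following map. -/

/-- The multiplication of the ultrafilter monad. -/
def ultraMul {X : Type u} (𝔛 : Ultrafilter (Ultrafilter X)) : Ultrafilter X :=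
  𝔛.bind id

/-- `A` belongs to `ultraMul 𝔛` iff `A^# = {𝔵 | A ∈ 𝔵}` belongs to `𝔛`. -/
theorem mem_ultraMul {X : Type u} (𝔛 : Ultrafilter (Ultrafilter X)) (A : Set X) :
    A ∈ ultraMul 𝔛 ↔ {𝔵 : Ultrafilter X | A ∈ 𝔵} ∈ 𝔛 :=
  Iff.rfl

/-- Eilenberg–Moore algebras for the ultrafilter monad on sets, that is, convergences of compact
Hausdorff topologies. -/
structure IsUltraAlgebra {X : Type u} (α : Ultrafilter X → X) : Prop where
  unit : ∀ x, α (pure x) = x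
  assoc : ∀ 𝔛 : Ultrafilter (Ultrafilter X), α (𝔛.map α) = α (ultraMul 𝔛)

/-- `ξ : UV → V` makes the ultrafilter monad and the quantale `V` an ultrafilter theory.
(The neutral element needs no axiom: `ξ (pure 1) = 1` is a case of `unit`.) -/
structure IsUltrafilterTheory {V : Type u} [CompleteLattice V] [CommMonoid V]
    (ξ : Ultrafilter V → V) : Prop extends IsUltraAlgebra ξ where
  /-- The tensor product is laxly continuous. -/
  tensor_le : ∀ 𝔴 : Ultrafilter (V × V),
    ξ (𝔴.map Prod.fst) * ξ (𝔴.map Prod.snd) ≤ ξ (𝔴.map fun p => p.1 * p.2)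
  /-- Compatibility with suprema, first part: the maps `ξ_X : V^X → V^{UX}`,
  `φ ↦ ξ · Uφ`, are monotone. -/
  monotone : ∀ {X : Type u} (φ ψ : X → V), φ ≤ ψ →
    ∀ 𝔵 : Ultrafilter X, ξ (𝔵.map φ) ≤ ξ (𝔵.map ψ)
  /-- Compatibility with suprema, second part: the maps `ξ_X` are natural in `X` for the
  `V`-powerset functor, which sends `f : X → Y` to
  `φ ↦ (y ↦ ⨆ over x with f x = y of φ x)`. -/
  natural : ∀ {X Y : Type u} (f : X → Y) (φ : X → V) (𝔶 : Ultrafilter Y),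
    ξ (𝔶.map fun y => ⨆ (x : X) (_ : f x = y), φ x) =
      ⨆ (𝔵 : Ultrafilter X) (_ : 𝔵.map f = 𝔶), ξ (𝔵.map φ)

/-- A strict ultrafilter theory: the tensor product is continuous. -/
structure IsStrictUltrafilterTheory {V : Type u} [CompleteLattice V] [CommMonoid V]
    (ξ : Ultrafilter V → V) : Prop extends IsUltrafilterTheory ξ where
  tensor_eq : ∀ 𝔴 : Ultrafilter (V × V),
    ξ (𝔴.map Prod.fst) * ξ (𝔴.map Prod.snd) = ξ (𝔴.map fun p => p.1 * p.2)

/-- The theory given by `ξ` is compatible with finite suprema. -/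
def CompatibleWithFiniteSups {V : Type u} [CompleteLattice V] (ξ : Ultrafilter V → V) : Prop :=
  ∀ 𝔴 : Ultrafilter (V × V),
    ξ (𝔴.map Prod.fst) ⊔ ξ (𝔴.map Prod.snd) = ξ (𝔴.map fun p => p.1 ⊔ p.2)

/-- The canonical map `ξ(𝔳) = ⨅ A ∈ 𝔳, ⨆ A`. -/
def canonicalXi (V : Type u) [CompleteLattice V] (𝔳 : Ultrafilter V) : V :=
  ⨅ A ∈ {A : Set V | A ∈ 𝔳}, sSup A

/-- The extension `U_ξ r` of a `V`-relation `r : X ⇸ Y`. -/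
def extendRel {V : Type u} [CompleteLattice V] (ξ : Ultrafilter V → V) {X Y : Type u}
    (r : X → Y → V) (𝔵 : Ultrafilter X) (𝔶 : Ultrafilter Y) : V :=
  ⨆ (𝔴 : Ultrafilter (X × Y)) (_ : 𝔴.map Prod.fst = 𝔵 ∧ 𝔴.map Prod.snd = 𝔶),
    ξ (𝔴.map fun p => r p.1 p.2)

/-! ### Categories enriched in a quantale -/

section Enriched

variable {V : Type u} [CompleteLattice V] [CommMonoid V]

/-- A `V`-category structure on the set `X`. -/
structure VCat (V : Type u) [CompleteLattice V] [CommMonoid V] (X : Type u) where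
  rel : X → X → V
  refl : ∀ x, 1 ≤ rel x x
  trans : ∀ x y z, rel x y * rel y z ≤ rel x z

/-- `V`-functors. -/
def IsVFunctor {X Y : Type u} (a : VCat V X) (b : VCat V Y) (f : X → Y) : Prop :=
  ∀ x x', a.rel x x' ≤ b.rel (f x) (f x')

/-- `f ⊣ g` for `V`-functors `f : (X, a) → (Y, b)` and `g : (Y, b) → (X, a)`, with respect to the
underlying order `x ≤ y ↔ 1 ≤ a(x, y)` of a `V`-category. -/
structure IsVAdjoint {X Y : Type u} (a : VCat V X) (b : VCat V Y) (f : X → Y) (g : Y → X) :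
    Prop where
  left_functor : IsVFunctor a b f
  right_functor : IsVFunctor b a g
  unit : ∀ x, 1 ≤ a.rel x (g (f x))
  counit : ∀ y, 1 ≤ b.rel (f (g y)) y

/-- The dual `V`-category. -/
def VCat.op {X : Type u} (a : VCat V X) : VCat V X where
  rel x y := a.rel y x
  refl := a.refl
  trans x y z := by rw [mul_comm]; exact a.trans z y x

/-- The `V`-category structure induced along a map; along the inclusion of a subset it is the
structure of a `V`-subcategory. -/
def VCat.induced {X Y : Type u} (f : X → Y) (b : VCat V Y) : VCat V X where
  rel x y := b.rel (f x) (f y)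
  refl x := b.refl (f x)
  trans x y z := b.trans (f x) (f y) (f z)

/-- The `V`-category `G = (1, k)`. -/
def VCat.unitCat (V : Type u) [CompleteLattice V] [CommMonoid V] : VCat V PUnit.{u + 1} where
  rel _ _ := 1
  refl _ := le_rfl
  trans _ _ _ := (mul_one (1 : V)).le

/-- `V`-distributors `φ : (X, a) ⇸ (Y, b)`; the two conditions are the pointwise forms of
`φ · a ≤ φ` and `b · φ ≤ φ`. -/
@[ext] structure VDist {X Y : Type u} (a : VCat V X) (b : VCat V Y) where
  rel : X → Y → V
  act_right : ∀ x x' y, a.rel x x' * rel x' y ≤ rel x y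
  act_left : ∀ x y y', rel x y * b.rel y y' ≤ rel x y'

/-- `V`-distributors `G ⇸ X`. -/
abbrev Weight {X : Type u} (a : VCat V X) : Type u := VDist (VCat.unitCat V) a

namespace Weight

variable {X : Type u} {a : VCat V X}

/-- The value of a distributor `φ : G ⇸ X` at `x`. -/
def val (φ : Weight a) (x : X) : V := φ.rel PUnit.unit x

/-- A map `φ : X → V` with `φ(x) ⊗ a(x, y) ≤ φ(y)`, seen as a distributor `G ⇸ X`. -/
def mk (φ : X → V) (h : ∀ x y, φ x * a.rel x y ≤ φ y) : Weight a where
  rel _ x := φ x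
  act_right _ _ _ := (one_mul _).le
  act_left _ x y := h x y

theorem val_act (φ : Weight a) (x y : X) : φ.val x * a.rel x y ≤ φ.val y :=
  φ.act_left PUnit.unit x y

/-- `[φ, ψ] = ⨅ x, hom(φ x, ψ x)`. -/
def hom (φ ψ : Weight a) : V := ⨅ x, (φ.val x ⇨ᵣ ψ.val x)

variable [IsQuantale V]

/-- The least distributor `⊥ : G ⇸ X` (with constant value `⊥`). -/
def bot (a : VCat V X) : Weight a :=
  mk (fun _ => ⊥) fun x y => by simp

/-- The (pointwise) supremum of two distributors `G ⇸ X`. -/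
def sup (φ ψ : Weight a) : Weight a :=
  mk (fun x => φ.val x ⊔ ψ.val x) fun x y => by
    rw [Quantale.sup_mul_distrib]
    exact sup_le_sup (φ.val_act x y) (ψ.val_act x y)

/-- The tensor `u ⊗ φ`. -/
def tensor (u : V) (φ : Weight a) : Weight a :=
  mk (fun x => u * φ.val x) fun x y => by
    rw [mul_assoc]
    exact mul_le_mul_right (φ.val_act x y) u

theorem le_hom_iff (φ ψ : Weight a) (v : V) : v ≤ φ.hom ψ ↔ ∀ x, φ.val x * v ≤ ψ.val x := by
  simp [hom, Quantale.rightMulResiduation_le_iff_mul_le]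

/-- The `V`-category `V-Dist(G, X)` with structure `[φ, ψ]`. -/
def cat (a : VCat V X) : VCat V (Weight a) where
  rel φ ψ := φ.hom ψ
  refl φ := (le_hom_iff _ _ _).2 fun x => (mul_one _).le
  trans φ ψ χ := (le_hom_iff _ _ _).2 fun x => by
    rw [← mul_assoc]
    exact (mul_le_mul_left ((le_hom_iff φ ψ _).1 le_rfl x) _).trans
      ((le_hom_iff ψ χ _).1 le_rfl x)

/-- `φ₀ : G ⇸ X` is codirected: `[φ₀, -]` preserves finite suprema and tensors. -/
structure IsCodirected (φ₀ : Weight a) : Prop where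
  hom_bot : φ₀.hom (bot a) = ⊥
  hom_sup : ∀ φ φ' : Weight a, φ₀.hom (sup φ φ') = φ₀.hom φ ⊔ φ₀.hom φ'
  hom_tensor : ∀ (u : V) (φ : Weight a), φ₀.hom (tensor u φ) = u * φ₀.hom φ

/-- The representable distributor `x_* = a(x, -) : G ⇸ X`. -/
def representable (a : VCat V X) (x : X) : Weight a :=
  mk (fun y => a.rel x y) fun y z => a.trans x y z

theorem hom_representable (x : X) (φ : Weight a) : (representable a x).hom φ = φ.val x := by
  apply le_antisymm
  · have h := (le_hom_iff (representable a x) φ _).1 le_rfl x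
    refine le_trans ?_ h
    calc _ = 1 * (representable a x).hom φ := (one_mul _).symm
      _ ≤ _ := mul_le_mul_left (a.refl x) _
  · refine (le_hom_iff _ _ _).2 fun y => ?_
    rw [mul_comm]
    exact φ.val_act x y

theorem isCodirected_representable (a : VCat V X) (x : X) :
    IsCodirected (representable a x) where
  hom_bot := hom_representable x _
  hom_sup φ φ' := by simp only [hom_representable]; rfl
  hom_tensor u φ := by simp only [hom_representable]; rfl

end Weight

variable [IsQuantale V] {X : Type u}

/-- The set of all codirected distributors `G ⇸ X`. -/
abbrev CodirWeight (a : VCat V X) : Type u := {φ : Weight a // φ.IsCodirected}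

/-- The `V`-category of codirected distributors `G ⇸ X`, a `V`-subcategory of
`V-Dist(G, X)^op`. -/
def codirCat (a : VCat V X) : VCat V (CodirWeight a) :=
  VCat.induced Subtype.val (Weight.cat a).op

/-- The co-Yoneda map `x ↦ x_*` into the codirected distributors. -/
def coyoneda (a : VCat V X) (x : X) : CodirWeight a :=
  ⟨Weight.representable a x, Weight.isCodirected_representable a x⟩

/-- `(X, a)` is codirected complete: `x ↦ x_*`, as a `V`-functor from `X` to the `V`-category of
codirected distributors `G ⇸ X`, has a right adjoint `inf`. -/
def CodirectedComplete (a : VCat V X) : Prop :=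
  ∃ inf : CodirWeight a → X, IsVAdjoint a (codirCat a) (coyoneda a) inf

end Enriched

/-- `(X, a₀, α)` is a `V`-categorical compact Hausdorff space, where `a₀` is a `V`-category
structure on `X`: the map `α : UX → X` is an Eilenberg–Moore algebra structure for the ultrafilter
monad and a `V`-functor `(UX, U_ξ a₀) → (X, a₀)`. -/
structure IsVCompactHausdorff {V : Type u} [CompleteLattice V] [CommMonoid V]
    (ξ : Ultrafilter V → V) {X : Type u} (a₀ : VCat V X) (α : Ultrafilter X → X) : Prop
    extends IsUltraAlgebra α where
  functor : ∀ 𝔵 𝔶 : Ultrafilter X, extendRel ξ a₀.rel 𝔵 𝔶 ≤ a₀.rel (α 𝔵) (α 𝔶)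

end UltraTheory

namespace UltraTheory

variable {V : Type u}

/-! Let φ be codirected. Call A ⊆ X large if φ(y) ≤ ⋁_{x∈A} φ(x) ⊗ a(x,y) for all y. The sets that
are not large form a proper ideal: ∅ is not large since [φ,⊥] = ⊥ ≠ ⊤, X is large by reflexivity,
and closure under unions holds since [φ,-] preserves binary suprema and ⊤ = k is join-prime. Hence
some ultrafilter 𝔵 has only large members (`IsCodirected.exists_ultrafilter`), and its limit α(𝔵) is
the infimum of φ. As k = ⊤, largeness and the formula for ξ give φ(y) ≤ ξ(U a(-,y)(𝔵)) ≤ a(α(𝔵),y),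
hence a(x,α(𝔵)) ≤ [φ,a(x,-)]. Conversely, preservation of tensors forces ⋁φ = ⊤, so largeness gives
ξ(Uφ(𝔵)) = ⊤; tensoring with [φ,a(x,-)] yields [φ,a(x,-)] ≤ ξ(U a(x,-)(𝔵)) ≤ a(x,α(𝔵)). -/

/-- An approximated unit that is the top element is join-prime. -/
theorem UnitApproximated.eq_top_or_eq_top_of_sup [CompleteLattice V] [CommMonoid V]
    (happrox : UnitApproximated V) (hterminal : (1 : V) = ⊤) {u v : V} (h : u ⊔ v = ⊤) :
    u = ⊤ ∨ v = ⊤ := by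
  obtain ⟨-, hdir, hlub⟩ := happrox
  have below : ∀ w : V, TotallyBelow w 1 → w ≤ u ∨ w ≤ v := fun w hw => by
    -- The union of the two principal down-sets has supremum u ∨ v = ⊤.
    have := hw (LowerSet.Iic u ⊔ LowerSet.Iic v) (by
      rw [hterminal, ← h]
      exact sup_le (le_sSup (Or.inl le_rfl)) (le_sSup (Or.inr le_rfl)))
    simpa using this
  by_contra! hne
  have exists_not_le : ∀ z : V, z ≠ ⊤ → ∃ w, TotallyBelow w 1 ∧ ¬ w ≤ z := fun z hz => by
    by_contra! hall
    exact hz (top_le_iff.1 (hterminal ▸ hlub.2 hall))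
  obtain ⟨w₁, hw₁, h₁⟩ := exists_not_le u hne.1
  obtain ⟨w₂, hw₂, h₂⟩ := exists_not_le v hne.2
  -- Directedness merges the two witnesses into one that lies below neither u nor v.
  obtain ⟨w, hw, hw₁w, hw₂w⟩ := hdir w₁ hw₁ w₂ hw₂
  exact (below w hw).elim (fun hu => h₁ (hw₁w.trans hu)) fun hv => h₂ (hw₂w.trans hv)

/-- If ⊥ = ⊤, the empty down-set covers k, so nothing is totally below k. -/
theorem UnitApproximated.bot_ne_top [CompleteLattice V] [CommMonoid V]
    (happrox : UnitApproximated V) : (⊥ : V) ≠ ⊤ := fun h => by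
  obtain ⟨u, hu⟩ := happrox.1
  have : u ∈ (⊥ : LowerSet V) := hu ⊥ (le_top.trans (h ▸ bot_le))
  simp at this

/-- An ideal of sets not containing the whole set is avoided by some ultrafilter. -/
theorem exists_ultrafilter_forall_not {X : Type u} (p : Set X → Prop) (hempty : p ∅)
    (hmono : ∀ t, p t → ∀ s ⊆ t, p s) (hunion : ∀ s, p s → ∀ t, p t → p (s ∪ t))
    (huniv : ¬ p Set.univ) : ∃ 𝔵 : Ultrafilter X, ∀ A ∈ 𝔵, ¬ p A := by
  have : (Filter.comk p hempty hmono hunion).NeBot := by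
    rw [Filter.neBot_iff, Ne, ← Filter.empty_mem_iff_bot, Filter.mem_comk, Set.compl_empty]
    exact huniv
  refine ⟨Ultrafilter.of (Filter.comk p hempty hmono hunion), fun A hA hpA => ?_⟩
  have hAc : Aᶜ ∈ Ultrafilter.of (Filter.comk p hempty hmono hunion) :=
    Ultrafilter.of_le _ (by simpa [Filter.mem_comk] using hpA)
  exact (Ultrafilter.compl_mem_iff_notMem.1 hAc) hA

/-! ### Evaluating ξ and U_ξ at principal ultrafilters. -/

theorem map_const {X Y : Type u} (y : Y) (𝔵 : Ultrafilter X) :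
    𝔵.map (fun _ => y) = pure y :=
  Ultrafilter.coe_injective Filter.map_const

/-- Pushing 𝔶 forward along y ↦ (x, y) gives an ultrafilter with the required projections. Together
with the functoriality of α it yields ξ(U a(x,-)(𝔶)) ≤ a(x,α(𝔶)). -/
theorem le_extendRel_pure_left [CompleteLattice V] (ξ : Ultrafilter V → V) {X Y : Type u}
    (r : X → Y → V) (x : X) (𝔶 : Ultrafilter Y) :
    ξ (𝔶.map (r x)) ≤ extendRel ξ r (pure x) 𝔶 := by
  refine le_iSup₂_of_le (𝔶.map fun y => (x, y)) ⟨?_, ?_⟩ ?_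
  · rw [Ultrafilter.map_map]; exact map_const x 𝔶
  · rw [Ultrafilter.map_map]; exact Ultrafilter.map_id 𝔶
  · rw [Ultrafilter.map_map]; exact le_rfl

theorem le_extendRel_pure_right [CompleteLattice V] (ξ : Ultrafilter V → V) {X Y : Type u}
    (r : X → Y → V) (𝔵 : Ultrafilter X) (y : Y) :
    ξ (𝔵.map fun x => r x y) ≤ extendRel ξ r 𝔵 (pure y) := by
  refine le_iSup₂_of_le (𝔵.map fun x => (x, y)) ⟨?_, ?_⟩ ?_
  · rw [Ultrafilter.map_map]; exact Ultrafilter.map_id 𝔵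
  · rw [Ultrafilter.map_map]; exact map_const y 𝔵
  · rw [Ultrafilter.map_map]; exact le_rfl

theorem le_canonicalXi_map [CompleteLattice V] {X : Type u} (f : X → V) (𝔵 : Ultrafilter X)
    (v : V) (h : ∀ A ∈ 𝔵, v ≤ ⨆ x ∈ A, f x) : v ≤ canonicalXi V (𝔵.map f) :=
  le_iInf₂ fun B hB => (h (f ⁻¹' B) hB).trans (iSup₂_le fun _ hx => le_sSup hx)

/-- The constant u contributes ξ(pure u) = u, so lax continuity of ⊗ applies to x ↦ (φ(x), u). -/
theorem IsUltrafilterTheory.mul_const_le [CompleteLattice V] [CommMonoid V]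
    {ξ : Ultrafilter V → V} (hξ : IsUltrafilterTheory ξ) {X : Type u} (φ ψ : X → V) (u : V)
    (h : ∀ x, φ x * u ≤ ψ x) (𝔵 : Ultrafilter X) : ξ (𝔵.map φ) * u ≤ ξ (𝔵.map ψ) := by
  have := hξ.tensor_le (𝔵.map fun x => (φ x, u))
  simp only [Ultrafilter.map_map] at this
  have hu : ξ (𝔵.map (Prod.snd ∘ fun x => (φ x, u))) = u :=
    (congrArg ξ (map_const u 𝔵)).trans (hξ.unit u)
  rw [hu] at this
  exact this.trans (hξ.monotone _ ψ h 𝔵)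

/-! ### Codirected distributors and their infima. -/

namespace Weight

variable [CompleteLattice V] [CommMonoid V] [IsQuantale V] {X : Type u} {a : VCat V X}

theorem hom_eq_top_iff (hterminal : (1 : V) = ⊤) (φ ψ : Weight a) :
    φ.hom ψ = ⊤ ↔ ∀ x, φ.val x ≤ ψ.val x := by
  rw [← top_le_iff, ← hterminal, le_hom_iff]
  simp

/-- The distributor generated by the restriction of `φ` to `A`. -/
def restrict (φ : Weight a) (A : Set X) : Weight a :=
  mk (fun y => ⨆ x ∈ A, φ.val x * a.rel x y) fun y z => by
    -- Residuation moves the factor a(y,z) across, so that the supremum can be eliminated.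
    rw [mul_comm, ← Quantale.rightMulResiduation_le_iff_mul_le]
    refine iSup₂_le fun x hx => ?_
    rw [Quantale.rightMulResiduation_le_iff_mul_le, mul_comm, mul_assoc]
    exact le_iSup₂_of_le x hx (mul_le_mul_right (a.trans x y z) _)

theorem restrict_val (φ : Weight a) (A : Set X) (y : X) :
    (φ.restrict A).val y = ⨆ x ∈ A, φ.val x * a.rel x y := rfl

theorem restrict_empty (φ : Weight a) : φ.restrict ∅ = bot a := by
  ext _ y
  exact (restrict_val φ ∅ y).trans (by simp [bot, Weight.mk])

theorem restrict_union (φ : Weight a) (A B : Set X) :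
    φ.restrict (A ∪ B) = sup (φ.restrict A) (φ.restrict B) := by
  ext _ y
  exact (restrict_val φ _ y).trans (iSup_union (f := fun x => φ.val x * a.rel x y))

theorem hom_restrict_mono (hterminal : (1 : V) = ⊤) (φ : Weight a) {A B : Set X} (h : A ⊆ B)
    (hA : φ.hom (φ.restrict A) = ⊤) : φ.hom (φ.restrict B) = ⊤ := by
  rw [hom_eq_top_iff hterminal] at hA ⊢
  exact fun x => (hA x).trans (biSup_mono fun _ hz => h hz)

/-- With u = ⋁φ, tensor preservation at the constant ⊤ gives [φ,u] = u for the constant distributor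
u, while φ ≤ u gives [φ,u] = ⊤. -/
theorem IsCodirected.iSup_val (hterminal : (1 : V) = ⊤) {φ : Weight a} (hφ : φ.IsCodirected) :
    ⨆ x, φ.val x = ⊤ := by
  have htop : φ.hom (Weight.mk (fun _ => ⊤) fun _ _ => le_top) = ⊤ :=
    (hom_eq_top_iff hterminal _ _).2 fun _ => le_top
  have h := hφ.hom_tensor (⨆ x, φ.val x) (Weight.mk (fun _ => ⊤) fun _ _ => le_top)
  rw [htop.trans hterminal.symm, mul_one] at h
  rw [← h, hom_eq_top_iff hterminal]
  intro x
  change φ.val x ≤ (⨆ x, φ.val x) * (⊤ : V)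
  rw [← hterminal, mul_one]
  exact le_iSup φ.val x

/-- A codirected distributor is generated by its restriction to any member of a suitable
ultrafilter. -/
theorem IsCodirected.exists_ultrafilter (hterminal : (1 : V) = ⊤)
    (happrox : UnitApproximated V) {φ : Weight a} (hφ : φ.IsCodirected) :
    ∃ 𝔵 : Ultrafilter X, ∀ A ∈ 𝔵, ∀ y, φ.val y ≤ ⨆ x ∈ A, φ.val x * a.rel x y := by
  obtain ⟨𝔵, h𝔵⟩ := exists_ultrafilter_forall_not (fun A => φ.hom (φ.restrict A) ≠ ⊤)
    (by rw [restrict_empty, hφ.hom_bot]; exact happrox.bot_ne_top)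
    (fun t ht s hst hs => ht (hom_restrict_mono hterminal φ hst hs))
    (fun s hs t ht hst => by
      rw [restrict_union, hφ.hom_sup] at hst
      exact (happrox.eq_top_or_eq_top_of_sup hterminal hst).elim hs ht)
    (not_not.2 ((hom_eq_top_iff hterminal _ _).2 fun x => by
      rw [restrict_val]
      refine le_iSup₂_of_le x (Set.mem_univ x) ?_
      calc φ.val x = φ.val x * 1 := (mul_one _).symm
        _ ≤ _ := mul_le_mul_right (a.refl x) _))
  exact ⟨𝔵, fun A hA => (hom_eq_top_iff hterminal _ _).1 (not_not.1 (h𝔵 A hA))⟩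

/-- In a `V`-categorical compact Hausdorff space every codirected distributor has an infimum. -/
theorem IsCodirected.exists_inf (hterminal : (1 : V) = ⊤) (happrox : UnitApproximated V)
    (hξ : IsUltrafilterTheory (canonicalXi V)) {α : Ultrafilter X → X}
    (hX : IsVCompactHausdorff (canonicalXi V) a α) {φ : Weight a} (hφ : φ.IsCodirected) :
    ∃ y, ∀ x, φ.hom (representable a x) = a.rel x y := by
  obtain ⟨𝔵, h𝔵⟩ := hφ.exists_ultrafilter hterminal happrox
  refine ⟨α 𝔵, fun x => le_antisymm ?_ ((le_hom_iff _ _ _).2 fun y => ?_)⟩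
  · have hone : (1 : V) ≤ canonicalXi V (𝔵.map φ.val) := by
      refine le_canonicalXi_map _ _ _ fun A hA => ?_
      rw [hterminal, ← hφ.iSup_val hterminal]
      refine iSup_le fun y => (h𝔵 A hA y).trans (iSup₂_mono fun z _ => ?_)
      calc φ.val z * a.rel z y ≤ φ.val z * 1 :=
            mul_le_mul_right (hterminal ▸ le_top) _
        _ = φ.val z := mul_one _
    calc φ.hom (representable a x) = 1 * φ.hom (representable a x) := (one_mul _).symm
      _ ≤ canonicalXi V (𝔵.map φ.val) * φ.hom (representable a x) := mul_le_mul_left hone _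
      _ ≤ canonicalXi V (𝔵.map (a.rel x)) :=
        hξ.mul_const_le _ _ _ ((le_hom_iff φ (representable a x) _).1 le_rfl) 𝔵
      _ ≤ a.rel (α (pure x)) (α 𝔵) :=
        (le_extendRel_pure_left _ a.rel x 𝔵).trans (hX.functor _ _)
      _ = a.rel x (α 𝔵) := by rw [hX.unit]
  · have hy : φ.val y ≤ a.rel (α 𝔵) y := by
      calc φ.val y ≤ canonicalXi V (𝔵.map fun z => a.rel z y) := by
            refine le_canonicalXi_map _ _ _ fun A hA =>
              (h𝔵 A hA y).trans (iSup₂_mono fun z _ => ?_)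
            calc φ.val z * a.rel z y ≤ 1 * a.rel z y :=
                  mul_le_mul_left (hterminal ▸ le_top) _
              _ = a.rel z y := one_mul _
        _ ≤ a.rel (α 𝔵) (α (pure y)) :=
          (le_extendRel_pure_right _ a.rel 𝔵 y).trans (hX.functor _ _)
        _ = a.rel (α 𝔵) y := by rw [hX.unit]
    rw [mul_comm]
    exact (mul_le_mul_right hy _).trans (a.trans x (α 𝔵) y)

end Weight

/-- The counit is the infimum formula at x = inf φ; functoriality of inf follows by composing it
with [ψ,φ]. -/
theorem codirectedComplete_of_exists_inf [CompleteLattice V] [CommMonoid V] [IsQuantale V]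
    {X : Type u} (a : VCat V X)
    (h : ∀ φ : Weight a, φ.IsCodirected →
      ∃ y, ∀ x, φ.hom (Weight.representable a x) = a.rel x y) :
    CodirectedComplete a := by
  choose inf hinf using fun φ : CodirWeight a => h φ.1 φ.2
  refine ⟨inf, ?_, ?_, ?_, ?_⟩
  · exact fun x x' => (Weight.hom_representable x' (Weight.representable a x)).ge
  · intro φ ψ
    have hφ : 1 ≤ φ.1.hom (Weight.representable a (inf φ)) :=
      (a.refl (inf φ)).trans (hinf φ (inf φ)).ge
    calc ψ.1.hom φ.1 = ψ.1.hom φ.1 * 1 := (mul_one _).symm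
      _ ≤ ψ.1.hom φ.1 * φ.1.hom (Weight.representable a (inf φ)) := mul_le_mul_right hφ _
      _ ≤ ψ.1.hom (Weight.representable a (inf φ)) := (Weight.cat a).trans _ _ _
      _ = a.rel (inf φ) (inf ψ) := hinf ψ (inf φ)
  · exact fun x => ((Weight.cat a).refl _).trans (hinf (coyoneda a x) x).le
  · exact fun φ => (a.refl (inf φ)).trans (hinf φ (inf φ)).ge

end UltraTheory

theorem mainTheorem1 {V : Type u} [CompletelyDistribLattice V] [CommMonoid V] [IsQuantale V]
    (ξ : Ultrafilter V → V) (hstrict : UltraTheory.IsStrictUltrafilterTheory ξ)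
    (hsup : UltraTheory.CompatibleWithFiniteSups ξ)
    (hξ : ξ = UltraTheory.canonicalXi V)
    (hterminal : (1 : V) = ⊤) (happrox : UltraTheory.UnitApproximated V)
    {X : Type u} (a₀ : UltraTheory.VCat V X) (α : Ultrafilter X → X)
    (hX : UltraTheory.IsVCompactHausdorff ξ a₀ α) :
    UltraTheory.CodirectedComplete a₀ := by
  subst hξ
  exact UltraTheory.codirectedComplete_of_exists_inf a₀ fun _ hφ =>
    hφ.exists_inf hterminal happrox hstrict.toIsUltrafilterTheory hX
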